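/- Let $X$ be a nonempty countable set, let $b\colon X\times X\to[0,\infty)$ satisfy $b(x,y)=b(y,x)$, $b(x,x)=0$ and $\sum_{z\in X}b(x,z)<\infty$ for all $x,y\in X$, and let $\mu\colon X\to(0,\infty)$. Let $\ell^2(X,\mu)$ be the Hilbert space of functions $f\colon X\to\mathbb{C}$ with $\sum_{x}\mu(x)|f(x)|^2<\infty$, with inner product $(f,g)=\sum_x\mu(x)f(x)\overline{g(x)}$ and norm $\|\cdot\|$, and let $C_c(X)$ be the space of finitely supported functions $X\to\mathbb{C}$. Assume the finiteness condition (FC): for every $x\in X$ the function $y\mapsto b(x,y)/\mu(y)$ belongs to $\ell^2(X,\mu)$. Let $V_1\colon X\to\mathbb{R}$ and, for $u\in C_c(X)$, put $$\mathcal{L}_{V_1}u(x)=\frac{1}{\mu(x)}\sum_{y\in X}b(x,y)\,(u(x)-u(y))+V_1(x)u(x),\qquad x\in X;$$ by (FC) this is an operator in $\ell^2(X,\mu)$ with domain $C_c(X)$, and it is symmetric. Assume that it is lower semi-bounded: there is $C\in\mathbb{R}$ with $(\mathcal{L}_{V_1}u,u)\ge C\|u\|^2$ for all $u\in C_c(X)$.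 Let $h$ be the closure of the form $u\mapsto(\mathcal{L}_{V_1}u,u)$, $u\in C_c(X)$, and let $L_{V_1}$, the Friedrichs extension of $\mathcal{L}_{V_1}|_{C_c(X)}$, be the self-adjoint operator associated with $h$. Let $\lambda_0(h)$ be the largest $c\in\mathbb{R}$ with $h(u)\ge c\|u\|^2$ for all $u\in\mathrm{Dom}(h)$, and for $\beta>0$ let $\|u\|_{h}^2=h(u)+(\beta-\lambda_0(h))\|u\|^2$ be the form norm (different $\beta$ give equivalent norms). Then $L_{V_1}$ has a positive form core: for every $u\in\mathrm{Dom}(h)$ with $u(x)\ge 0$ for all $x\in X$ there is a sequence $u_k\in C_c(X)$ with $u_k(x)\ge 0$ for all $x\in X$ such that $\|u_k-u\|_{h}\to 0$ as $k\to\infty$. -/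

import Mathlib

open Filter Topology
open scoped InnerProductSpace ComplexOrder

noncomputable section

/-! ### Sesquilinear forms in a complex inner product space

As everywhere in Mathlib, inner products and sesquilinear forms are conjugate-linear in the first
and linear in the second argument. -/

/-- A sesquilinear form in `E`, defined on a linear subspace of `E`. -/
structure SesqForm (E : Type*) [NormedAddCommGroup E] [InnerProductSpace ℂ E] where
  domain : Submodule ℂ E
  form : domain →ₗ⋆[ℂ] domain →ₗ[ℂ] ℂ

namespace SesqForm

variable {E : Type*} [NormedAddCommGroup E] [InnerProductSpace ℂ E]

/-- The form `(u, v) ↦ ⟪u, T v⟫` on the domain of an operator `T`. -/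
def ofOperator (T : E →ₗ.[ℂ] E) : SesqForm E where
  domain := T.domain
  form := LinearMap.mk₂'ₛₗ (starRingEnd ℂ) (RingHom.id ℂ) (fun u v => ⟪(u : E), T v⟫_ℂ)
    (fun u v w => by simp)
    (fun c u v => by simp [mul_comm])
    (fun u v w => by simp [LinearPMap.map_add])
    (fun c u v => by simp [LinearPMap.map_smul])

/-- The quadratic form of `t` (for a Hermitian form, `t u u` is real). -/
def quad (t : SesqForm E) (u : t.domain) : ℝ := (t.form u u).re

def IsHermitian (t : SesqForm E) : Prop :=
  ∀ u v : t.domain, t.form u v = starRingEnd ℂ (t.form v u)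

def IsLowerSemibounded (t : SesqForm E) : Prop :=
  ∃ C : ℝ, ∀ u : t.domain, C * ‖(u : E)‖ ^ 2 ≤ t.quad u

/-- The largest lower bound `λ₀` of the form. -/
def lowerBound (t : SesqForm E) : ℝ :=
  sSup {C : ℝ | ∀ u : t.domain, C * ‖(u : E)‖ ^ 2 ≤ t.quad u}

/-- The form norm `‖u‖_t`, with `‖u‖_t ^ 2 = t(u) + (β - λ₀) ‖u‖ ^ 2`, for a parameter `β > 0`. -/
def formNorm (t : SesqForm E) (β : ℝ) (u : t.domain) : ℝ :=
  √(t.quad u + (β - t.lowerBound) * ‖(u : E)‖ ^ 2)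

/-- Closedness: if `s n → u` in `E` and `t(s n - s m) → 0`, then `u` is in the domain and
`t(s n - u) → 0`. -/
def IsClosed (t : SesqForm E) : Prop :=
  ∀ (s : ℕ → t.domain) (u : E), Tendsto (fun n => (s n : E)) atTop (𝓝 u) →
    Tendsto (fun p : ℕ × ℕ => t.quad (s p.1 - s p.2)) atTop (𝓝 0) →
    ∃ v : t.domain, (v : E) = u ∧ Tendsto (fun n => t.quad (s n - v)) atTop (𝓝 0)

/-- `c` is an extension of `t`. -/
def Extends (c t : SesqForm E) : Prop :=
  ∃ h : t.domain ≤ c.domain, ∀ u v : t.domain,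
    c.form (Submodule.inclusion h u) (Submodule.inclusion h v) = t.form u v

/-- `c` is the closure of `t`: a closed, Hermitian, lower semi-bounded extension of `t` for which
the domain of `t` is a core. There is at most one such `c`. -/
structure IsClosureOf (c t : SesqForm E) : Prop where
  isHermitian : c.IsHermitian
  isLowerSemibounded : c.IsLowerSemibounded
  isClosed : c.IsClosed
  extends_form : c.Extends t
  core : ∀ u : c.domain, ∃ s : ℕ → c.domain, (∀ n, (s n : E) ∈ t.domain) ∧
    Tendsto (fun n => (s n : E)) atTop (𝓝 (u : E)) ∧
    Tendsto (fun n => c.quad (s n - u)) atTop (𝓝 0)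

open Classical in
/-- The closure of a closable form (and `t` itself if `t` is not closable). -/
def closure (t : SesqForm E) : SesqForm E :=
  if h : ∃ c : SesqForm E, c.IsClosureOf t then h.choose else t

/-- The graph of the operator associated with a form: all `(u, w)` with `u` in the form domain and
`t v u = ⟪v, w⟫` for all `v` in the form domain. -/
def operatorGraph (t : SesqForm E) : Submodule ℂ (E × E) where
  carrier := {p | ∃ u : t.domain, (u : E) = p.1 ∧ ∀ v : t.domain, t.form v u = ⟪(v : E), p.2⟫_ℂ}
  add_mem' := by
    rintro p q ⟨u, hu, hp⟩ ⟨v, hv, hq⟩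
    exact ⟨u + v, by simp [hu, hv], fun w => by simp [hp, hq]⟩
  zero_mem' := ⟨0, by simp, fun w => by simp⟩
  smul_mem' := by
    rintro c p ⟨u, hu, hp⟩
    exact ⟨c • u, by simp [hu], fun w => by simp [hp]⟩

/-- The operator associated with a (densely defined) form. -/
def operator (t : SesqForm E) : E →ₗ.[ℂ] E := t.operatorGraph.toLinearPMap

/-- For a densely defined form the graph of the associated operator is `operatorGraph`. -/
theorem operator_graph (t : SesqForm E) (ht : Dense (t.domain : Set E)) :
    t.operator.graph = t.operatorGraph := by
  refine Submodule.toLinearPMap_graph_eq _ ?_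
  rintro ⟨x, y⟩ ⟨u, hu, h⟩ hx
  have hu0 : u = 0 := Subtype.ext (by simpa using hu.trans hx)
  refine ht.eq_zero_of_inner_right (𝕜 := ℂ) fun v hv => ?_
  rw [← h ⟨v, hv⟩, hu0, map_zero]

/-- `t` is the densely defined, Hermitian, lower semi-bounded and closed form whose associated
operator is `A`. There is at most one such `t`; its domain is the form domain of `A`. -/
structure IsFormOf (t : SesqForm E) (A : E →ₗ.[ℂ] E) : Prop where
  dense : Dense (t.domain : Set E)
  isHermitian : t.IsHermitian
  isLowerSemibounded : t.IsLowerSemibounded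
  isClosed : t.IsClosed
  operator_eq : t.operator = A

end SesqForm

/-- The Friedrichs extension of a densely defined, symmetric, lower semi-bounded operator `T`: the
operator associated with the closure of the form `⟪u, T v⟫` on the domain of `T`. -/
def friedrichsExtension {E : Type*} [NormedAddCommGroup E] [InnerProductSpace ℂ E]
    (T : E →ₗ.[ℂ] E) : E →ₗ.[ℂ] E :=
  (SesqForm.ofOperator T).closure.operator

/-! ### Weighted graphs -/

/-- A symmetric weighted graph with vertex set `X`, edge weight `b` and vertex weight `μ`. -/
structure WeightedGraph (X : Type*) where
  b : X → X → ℝ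
  b_nonneg : ∀ x y, 0 ≤ b x y
  b_symm : ∀ x y, b x y = b y x
  b_self : ∀ x, b x x = 0
  b_summable : ∀ x, Summable (b x)
  μ : X → ℝ
  μ_pos : ∀ x, 0 < μ x

namespace WeightedGraph

variable {X : Type*} (G : WeightedGraph X)

/-- The line `ℂ` over the vertex `x`, with the inner product `μ(x) * conj z * w`. -/
def Fiber (_ : WeightedGraph X) (_ : X) : Type := ℂ

abbrev fiberCore (x : X) : InnerProductSpace.Core ℂ ℂ where
  inner z w := (G.μ x : ℂ) * (starRingEnd ℂ z * w)
  conj_inner_symm z w := by simp [mul_comm]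
  re_inner_nonneg z := by
    have h := mul_nonneg (G.μ_pos x).le (Complex.normSq_nonneg z)
    rw [← Complex.normSq_eq_conj_mul_self, ← Complex.ofReal_mul]
    simpa using h
  add_left z w v := by simp; ring
  smul_left z w c := by simp; ring
  definite z h := by
    have := (G.μ_pos x).ne'
    simpa [this] using h

instance fiberNormedAddCommGroup (x : X) : NormedAddCommGroup (G.Fiber x) :=
  @InnerProductSpace.Core.toNormedAddCommGroup ℂ ℂ _ _ _ (G.fiberCore x)

instance fiberInnerProductSpace (x : X) : InnerProductSpace ℂ (G.Fiber x) :=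
  @InnerProductSpace.ofCore ℂ ℂ _ _ _ (G.fiberCore x).toCore

instance fiberFiniteDimensional (x : X) : FiniteDimensional ℂ (G.Fiber x) :=
  inferInstanceAs (FiniteDimensional ℂ ℂ)

instance fiberCompleteSpace (x : X) : CompleteSpace (G.Fiber x) :=
  FiniteDimensional.complete ℂ (G.Fiber x)

/-- A function `X → ℂ`, with its values seen in the fibers. -/
def lift (f : X → ℂ) (x : X) : G.Fiber x := f x

/-- The Hilbert space `ℓ²(X, μ)` of all `f : X → ℂ` with `∑ μ(x) |f(x)|² < ∞`. -/
abbrev L2 : Type _ := lp (fun x => G.Fiber x) 2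

variable {G}

/-- An element of `ℓ²(X, μ)` as a function. -/
def L2.fn (u : G.L2) (x : X) : ℂ := u x

theorem norm_lift_sq (f : X → ℂ) (x : X) : ‖G.lift f x‖ ^ 2 = G.μ x * ‖f x‖ ^ 2 := by
  have h : ‖G.lift f x‖ ^ 2 = (⟪G.lift f x, G.lift f x⟫_ℂ).re :=
    norm_sq_eq_re_inner (𝕜 := ℂ) (G.lift f x)
  rw [h]
  change ((G.μ x : ℂ) * (starRingEnd ℂ (f x) * f x)).re = _
  rw [← Complex.normSq_eq_conj_mul_self, ← Complex.ofReal_mul, Complex.ofReal_re,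
    Complex.normSq_eq_norm_sq]

/-- Membership in `ℓ²(X, μ)` means `∑ μ(x) |f(x)|² < ∞`. -/
theorem memℓp_lift_iff (f : X → ℂ) :
    Memℓp (G.lift f) 2 ↔ Summable fun x => G.μ x * ‖f x‖ ^ 2 := by
  rw [memℓp_gen_iff (by norm_num)]
  refine summable_congr fun x => ?_
  simpa using norm_lift_sq (G := G) f x

/-- The inner product of `ℓ²(X, μ)`. -/
theorem inner_eq (u v : G.L2) :
    ⟪u, v⟫_ℂ = ∑' x, (G.μ x : ℂ) * (starRingEnd ℂ (u.fn x) * v.fn x) :=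
  lp.inner_eq_tsum u v

variable (G)

/-- The finitely supported functions, as a subspace of `ℓ²(X, μ)`. -/
def Cc : Submodule ℂ G.L2 where
  carrier := {u | (Function.support u.fn).Finite}
  add_mem' {u v} hu hv := (hu.union hv).subset (Function.support_add u.fn v.fn)
  zero_mem' := by
    have : (L2.fn (0 : G.L2)) = 0 := rfl
    simp [this]
  smul_mem' c u hu := hu.subset (Function.support_const_smul_subset c u.fn)

/-- The finiteness condition: `y ↦ b(x,y) / μ(y)` belongs to `ℓ²(X, μ)` for every vertex `x`. -/
def FinitenessCondition : Prop :=
  ∀ x, Summable fun y => G.μ y * (G.b x y / G.μ y) ^ 2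

/-- The formal Schrödinger operator with potential `V`. It is meant for those `f` for which all
the sums `∑ y, b(x,y) |f(y)|` are finite, in particular for all finitely supported `f`. -/
def formalSchrodinger (V : X → ℝ) (f : X → ℂ) (x : X) : ℂ :=
  1 / (G.μ x : ℂ) * ∑' y, (G.b x y : ℂ) * (f x - f y) + (V x : ℂ) * f x


variable {G}

theorem summable_of_finite_support {f : X → ℂ} (hf : (Function.support f).Finite) (x : X) :
    Summable fun y => (G.b x y : ℂ) * (f x - f y) := by
  have h1 : Summable fun y => (G.b x y : ℂ) * f x :=
    (Complex.ofRealCLM.summable (G.b_summable x)).mul_right _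
  have h2 : Summable fun y => (G.b x y : ℂ) * f y :=
    summable_of_hasFiniteSupport (hf.subset fun y hy => by
      simp only [Function.mem_support] at hy ⊢
      exact right_ne_zero_of_mul hy)
  simpa [mul_sub] using h1.sub h2

theorem formalSchrodinger_eq (V : X → ℝ) {f : X → ℂ} (hf : (Function.support f).Finite) (x : X) :
    G.formalSchrodinger V f x =
      (1 / (G.μ x : ℂ) * (∑' y, (G.b x y : ℂ)) + (V x : ℂ)) * f x
        - ∑ y ∈ hf.toFinset, f y * ((G.b y x / G.μ x : ℝ) : ℂ) := by
  have h1 : Summable fun y => (G.b x y : ℂ) := Complex.ofRealCLM.summable (G.b_summable x)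
  have h2 : HasSum (fun y => (G.b x y : ℂ) * f y) (∑ y ∈ hf.toFinset, (G.b x y : ℂ) * f y) :=
    hasSum_sum_of_ne_finset_zero fun y hy => by
      have : f y = 0 := by simpa using hy
      simp [this]
  have h3 : ∑' y, (G.b x y : ℂ) * (f x - f y) =
      (∑' y, (G.b x y : ℂ)) * f x - ∑ y ∈ hf.toFinset, (G.b x y : ℂ) * f y := by
    simpa [mul_sub] using ((h1.hasSum.mul_right (f x)).sub h2).tsum_eq
  have h4 : ∑ y ∈ hf.toFinset, f y * ((G.b y x / G.μ x : ℝ) : ℂ) =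
      1 / (G.μ x : ℂ) * ∑ y ∈ hf.toFinset, (G.b x y : ℂ) * f y := by
    rw [Finset.mul_sum]
    refine Finset.sum_congr rfl fun y _ => ?_
    rw [G.b_symm y x]
    push_cast
    ring
  rw [formalSchrodinger, h3, h4]
  ring

/-- Under the finiteness condition the Schrödinger operator maps finitely supported functions
into `ℓ²(X, μ)`. -/
theorem memℓp_formalSchrodinger (hG : G.FinitenessCondition) (V : X → ℝ) {f : X → ℂ}
    (hf : (Function.support f).Finite) :
    Memℓp (G.lift (G.formalSchrodinger V f)) 2 := by
  have h1 : Memℓp (G.lift fun x =>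
      (1 / (G.μ x : ℂ) * (∑' y, (G.b x y : ℂ)) + (V x : ℂ)) * f x) 2 := by
    rw [memℓp_lift_iff]
    refine summable_of_hasFiniteSupport (hf.subset fun y hy => ?_)
    simp only [Function.mem_support] at hy ⊢
    rintro h
    simp [h] at hy
  have h2 : ∀ y, Memℓp (G.lift fun x => f y * ((G.b y x / G.μ x : ℝ) : ℂ)) 2 := by
    intro y
    rw [memℓp_lift_iff]
    refine ((hG y).mul_left (‖f y‖ ^ 2)).congr fun x => ?_
    rw [norm_mul, Complex.norm_real, mul_pow, Real.norm_eq_abs, sq_abs]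
    ring
  have h3 := h1.sub (Memℓp.finsetSum hf.toFinset fun y _ => h2 y)
  have h4 : G.lift (G.formalSchrodinger V f) = _ :=
    funext fun x => formalSchrodinger_eq V hf x
  rw [h4]
  exact h3

/-- The Schrödinger operator with potential `V`, as an operator in `ℓ²(X, μ)` whose domain
consists of the finitely supported functions. -/
def schrodinger (hG : G.FinitenessCondition) (V : X → ℝ) : G.L2 →ₗ.[ℂ] G.L2 where
  domain := G.Cc
  toFun :=
    { toFun := fun u => ⟨G.lift (G.formalSchrodinger V (L2.fn u.1)),
        memℓp_formalSchrodinger hG V u.2⟩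
      map_add' := fun u v => by
        apply lp.ext
        funext x
        have hu := summable_of_finite_support (G := G) u.2 x
        have hv := summable_of_finite_support (G := G) v.2 x
        change G.formalSchrodinger V (fun x => L2.fn u.1 x + L2.fn v.1 x) x =
          G.formalSchrodinger V (L2.fn u.1) x + G.formalSchrodinger V (L2.fn v.1) x
        have h : ∑' y, (G.b x y : ℂ) *
            ((L2.fn u.1 x + L2.fn v.1 x) - (L2.fn u.1 y + L2.fn v.1 y)) =
            ∑' y, (G.b x y : ℂ) * (L2.fn u.1 x - L2.fn u.1 y) +
              ∑' y, (G.b x y : ℂ) * (L2.fn v.1 x - L2.fn v.1 y) := by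
          rw [← hu.tsum_add hv]
          exact tsum_congr fun y => by ring
        simp only [formalSchrodinger, h]
        ring
      map_smul' := fun c u => by
        apply lp.ext
        funext x
        change G.formalSchrodinger V (fun x => c * L2.fn u.1 x) x =
          c * G.formalSchrodinger V (L2.fn u.1) x
        have h : ∑' y, (G.b x y : ℂ) * (c * L2.fn u.1 x - c * L2.fn u.1 y) =
            c * ∑' y, (G.b x y : ℂ) * (L2.fn u.1 x - L2.fn u.1 y) := by
          rw [← tsum_mul_left]
          exact tsum_congr fun y => by ring
        simp only [formalSchrodinger, h]
        ring }

/-- An operator `A` in `ℓ²(X, μ)` has a positive form core: every non-negative `u` in its form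
domain is the limit, in the form norm, of non-negative finitely supported functions. -/
def HasPositiveFormCore (A : G.L2 →ₗ.[ℂ] G.L2) : Prop :=
  ∃ t : SesqForm G.L2, t.IsFormOf A ∧
    ∀ u : t.domain, (∀ x, 0 ≤ L2.fn u.1 x) →
      ∃ s : ℕ → t.domain, (∀ k, (s k : G.L2) ∈ G.Cc ∧ ∀ x, 0 ≤ L2.fn (s k).1 x) ∧
        ∀ β : ℝ, 0 < β → Tendsto (fun k => t.formNorm β (s k - u)) atTop (𝓝 0)

end WeightedGraph

end

noncomputable section

namespace SesqForm

variable {E : Type*} [NormedAddCommGroup E] [InnerProductSpace ℂ E]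

/-! Take finitely supported `s n` converging to `u ≥ 0` in the form sense and replace them by their
absolute values `|s n|`. These are again finitely supported, converge to `u` in `ℓ²(X, μ)` because
`||s n| - u| ≤ |s n - u|` pointwise (`L2.norm_abs_sub_le`), and have no larger form value because `b
≥ 0` (`re_inner_schrodinger_abs_le`).

The absolute value is not linear, so form convergence of `|s n|` needs an argument:
`IsClosureOf.tendsto_quad_sub`. It is a concrete version of "weak convergence without gain of norm
is strong convergence". Expanding the form at `a n - s m`, the cross term is an inner product with
the fixed vector `T (s m)`, so convergence in `E` alone controls it.

The closure is defined by choice, so its existence is also needed. The domain of the operator is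
completed in the form norm, and the inclusion into `E` extends to an injective map on the completion
(`exists_isClosureOf_of_inner`). -/

theorem re_mul_inner_self (k : ℝ) (x : E) : ((k : ℂ) * ⟪x, x⟫_ℂ).re = k * ‖x‖ ^ 2 := by
  rw [Complex.re_ofReal_mul, norm_sq_eq_re_inner (𝕜 := ℂ) x]
  rfl

/-! ### Closed forms from Hilbert spaces embedded in `E` -/

section OfEmbedding

variable {H : Type*} [NormedAddCommGroup H] [InnerProductSpace ℂ H]

/-- The form on the range of an injective map `j : H → E` which corresponds to the inner product
of `H`, shifted by `k` times the inner product of `E`. -/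
def ofEmbedding (j : H →L[ℂ] E) (hj : Function.Injective j) (k : ℝ) : SesqForm E where
  domain := LinearMap.range (j : H →ₗ[ℂ] E)
  form :=
    let e := (LinearEquiv.ofInjective (j : H →ₗ[ℂ] E) hj).symm
    LinearMap.mk₂'ₛₗ (starRingEnd ℂ) (RingHom.id ℂ)
      (fun u v => ⟪e u, e v⟫_ℂ - k * ⟪(u : E), (v : E)⟫_ℂ)
      (fun u v w => by simp; ring)
      (fun c u v => by simp; ring)
      (fun u v w => by simp; ring)
      (fun c u v => by simp; ring)

variable (j : H →L[ℂ] E) (hj : Function.Injective j) (k : ℝ)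

/-- The image of a vector of `H` in the domain of the form `ofEmbedding`. -/
def embed (f : H) : (ofEmbedding j hj k).domain := ⟨j f, ⟨f, rfl⟩⟩

@[simp]
theorem coe_embed (f : H) : (embed j hj k f : E) = j f := rfl

theorem embed_sub (f g : H) : embed j hj k (f - g) = embed j hj k f - embed j hj k g :=
  Subtype.ext (map_sub j f g)

theorem embed_surjective : Function.Surjective (embed j hj k) := by
  rintro ⟨_, f, rfl⟩
  exact ⟨f, rfl⟩

theorem ofEmbedding_form (f g : H) :
    (ofEmbedding j hj k).form (embed j hj k f) (embed j hj k g) =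
      ⟪f, g⟫_ℂ - k * ⟪j f, j g⟫_ℂ := by
  have h : ∀ f : H, (LinearEquiv.ofInjective (j : H →ₗ[ℂ] E) hj).symm (embed j hj k f) = f :=
    fun f => (LinearEquiv.symm_apply_eq _).2 rfl
  change ⟪(LinearEquiv.ofInjective (j : H →ₗ[ℂ] E) hj).symm (embed j hj k f),
    (LinearEquiv.ofInjective (j : H →ₗ[ℂ] E) hj).symm (embed j hj k g)⟫_ℂ - _ = _
  rw [h, h]
  rfl

theorem ofEmbedding_quad (f : H) :
    (ofEmbedding j hj k).quad (embed j hj k f) = ‖f‖ ^ 2 - k * ‖j f‖ ^ 2 := by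
  rw [quad, ofEmbedding_form, Complex.sub_re, re_mul_inner_self,
    norm_sq_eq_re_inner (𝕜 := ℂ) f]
  rfl

theorem ofEmbedding_isHermitian : (ofEmbedding j hj k).IsHermitian := by
  intro u v
  obtain ⟨f, rfl⟩ := embed_surjective j hj k u
  obtain ⟨g, rfl⟩ := embed_surjective j hj k v
  simp [ofEmbedding_form]

theorem ofEmbedding_isLowerSemibounded (hn : ∀ f, ‖j f‖ ≤ ‖f‖) :
    (ofEmbedding j hj k).IsLowerSemibounded := by
  refine ⟨1 - k, fun u => ?_⟩
  obtain ⟨f, rfl⟩ := embed_surjective j hj k u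
  rw [ofEmbedding_quad, coe_embed]
  have := pow_le_pow_left₀ (norm_nonneg _) (hn f) 2
  linarith

/-- Adding `k` times the squared distance in `E` to the form recovers the squared distance in `H`,
so the preimages form a Cauchy sequence in `H`; completeness supplies the limit. -/
theorem ofEmbedding_isClosed [CompleteSpace H] : (ofEmbedding j hj k).IsClosed := by
  intro s u hs hq
  choose f hf using fun n => embed_surjective j hj k (s n)
  obtain rfl : (fun n => embed j hj k (f n)) = s := funext hf
  simp only [coe_embed, ← embed_sub, ofEmbedding_quad] at hs hq
  have hj0 : Tendsto (fun p : ℕ × ℕ => ‖j (f p.1 - f p.2)‖) atTop (𝓝 0) := by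
    have := cauchySeq_iff_tendsto_dist_atTop_0.1 hs.cauchySeq
    simpa [dist_eq_norm] using this
  have hc : CauchySeq f := by
    rw [cauchySeq_iff_tendsto_dist_atTop_0]
    have h := hq.add ((hj0.pow 2).const_mul k)
    have h' := (Real.continuous_sqrt.tendsto _).comp h
    simpa [Function.comp_def, dist_eq_norm] using h'
  obtain ⟨g, hg⟩ := cauchySeq_tendsto_of_complete hc
  have hjg : Tendsto (fun n => j (f n)) atTop (𝓝 (j g)) := (j.continuous.tendsto g).comp hg
  refine ⟨embed j hj k g, tendsto_nhds_unique hjg hs, ?_⟩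
  simp only [← embed_sub, ofEmbedding_quad]
  have h : Continuous fun w : H => ‖w - g‖ ^ 2 - k * ‖j (w - g)‖ ^ 2 := by fun_prop
  simpa [Function.comp_def] using (h.tendsto g).comp hg

end OfEmbedding

/-! ### Closability of operator forms -/

/-- A form whose shift by `k` is an inner product, stronger than that of `E` and represented by an
operator, is closable. -/
theorem exists_isClosureOf_of_inner [CompleteSpace E] {F : Type*} [NormedAddCommGroup F]
    [InnerProductSpace ℂ F] (t : SesqForm E) (e : t.domain ≃ₗ[ℂ] F) (k : ℝ)
    (hinner : ∀ u v, ⟪e u, e v⟫_ℂ = t.form u v + k * ⟪(u : E), (v : E)⟫_ℂ)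
    (hnorm : ∀ u : t.domain, ‖(u : E)‖ ≤ ‖e u‖)
    (A : t.domain → E) (hA : ∀ u v, ⟪e u, e v⟫_ℂ = ⟪A u, (v : E)⟫_ℂ) :
    ∃ c : SesqForm E, c.IsClosureOf t := by
  let H := UniformSpace.Completion F
  let i : F →ₗ[ℂ] H := (UniformSpace.Completion.toComplL (𝕜 := ℂ) (E := F) : F →ₗ[ℂ] H)
  let J : F →ₗ[ℂ] E := t.domain.subtype ∘ₗ (e.symm : F →ₗ[ℂ] t.domain)
  have hi : DenseRange i := UniformSpace.Completion.denseRange_coe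
  have hin : ∀ f, ‖i f‖ = ‖f‖ := UniformSpace.Completion.norm_coe
  have hii : ∀ f g, ⟪i f, i g⟫_ℂ = ⟪f, g⟫_ℂ := UniformSpace.Completion.inner_coe
  have hJ : ∀ f, ‖J f‖ ≤ 1 * ‖i f‖ := fun f => by
    simpa [J, hin] using hnorm (e.symm f)
  let j : H →L[ℂ] E := J.extendOfNorm i
  have hji : ∀ f, j (i f) = J f := fun f => LinearMap.extendOfNorm_eq hi ⟨1, hJ⟩ f
  have hJe : ∀ u, J (e u) = u := fun u => by simp [J]
  have hjn : ∀ w, ‖j w‖ ≤ ‖w‖ := fun w => by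
    simpa using LinearMap.norm_extendOfNorm_apply_le hi 1 hJ w
  -- Both sides are continuous in `w`, so the representation by `A` extends from the dense image of
  -- `F` to the completion.
  have hjA : ∀ u w, ⟪i (e u), w⟫_ℂ = ⟪A u, j w⟫_ℂ := fun u w => by
    refine hi.induction_on (p := fun w => ⟪i (e u), w⟫_ℂ = ⟪A u, j w⟫_ℂ) w
      (isClosed_eq (by fun_prop) (by fun_prop)) fun f => ?_
    obtain ⟨v, rfl⟩ := e.surjective f
    rw [hii, hji, hJe, hA]
  -- This is closability proper: by `hjA` a vector in the kernel of `j` is orthogonal to the dense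
  -- image of `F`.
  have hj : Function.Injective j := by
    refine (injective_iff_map_eq_zero j).2 fun w hw => ?_
    refine hi.eq_zero_of_inner_right (𝕜 := ℂ) fun f => ?_
    obtain ⟨u, rfl⟩ := e.surjective f
    rw [hjA, hw, inner_zero_right]
  have hemb : ∀ u : t.domain, (embed j hj k (i (e u)) : E) = u := fun u => by
    rw [coe_embed, hji, hJe]
  have hle : t.domain ≤ (ofEmbedding j hj k).domain := fun u hu => by
    have h := (embed j hj k (i (e ⟨u, hu⟩))).2
    rwa [hemb] at h
  refine ⟨ofEmbedding j hj k, ofEmbedding_isHermitian j hj k,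
    ofEmbedding_isLowerSemibounded j hj k hjn, ofEmbedding_isClosed j hj k, ⟨hle, fun u v => ?_⟩,
    fun u => ?_⟩
  · have h : ∀ u : t.domain, Submodule.inclusion hle u = embed j hj k (i (e u)) :=
      fun u => Subtype.ext (hemb u).symm
    rw [h, h, ofEmbedding_form, hii, hinner, hji, hji, hJe, hJe]
    ring
  · obtain ⟨w, rfl⟩ := embed_surjective j hj k u
    obtain ⟨x, hx, hxw⟩ := mem_closure_iff_seq_limit.1 (hi w)
    choose f hf using hx
    obtain rfl : (fun n => i (f n)) = x := funext hf
    refine ⟨fun n => embed j hj k (i (f n)), fun n => ?_, ?_, ?_⟩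
    · rw [coe_embed, hji]
      exact Subtype.property _
    · exact (j.continuous.tendsto w).comp hxw
    · simp only [← embed_sub, ofEmbedding_quad]
      have h : Continuous fun v : H => ‖v - w‖ ^ 2 - k * ‖j (v - w)‖ ^ 2 := by fun_prop
      simpa [Function.comp_def] using (h.tendsto w).comp hxw

/-- The domain of an operator, to be equipped with a form inner product. -/
def FormDomain (T : E →ₗ.[ℂ] E) : Type _ := T.domain

instance (T : E →ₗ.[ℂ] E) : AddCommGroup (FormDomain T) :=
  inferInstanceAs (AddCommGroup T.domain)

instance (T : E →ₗ.[ℂ] E) : Module ℂ (FormDomain T) :=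
  inferInstanceAs (Module ℂ T.domain)

/-- The form of a symmetric, lower semi-bounded operator is closable. -/
theorem exists_isClosureOf_ofOperator [CompleteSpace E] (T : E →ₗ.[ℂ] E)
    (hT : ∀ u v : T.domain, ⟪(u : E), T v⟫_ℂ = ⟪T u, (v : E)⟫_ℂ)
    {C : ℝ} (hC : ∀ u : T.domain, C * ‖(u : E)‖ ^ 2 ≤ (⟪(u : E), T u⟫_ℂ).re) :
    ∃ c : SesqForm E, c.IsClosureOf (ofOperator T) := by
  -- With this shift the form dominates the squared norm of `E` with constant 1.
  let k : ℝ := 1 - C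
  have hk : ∀ u : T.domain,
      ‖(u : E)‖ ^ 2 ≤ (⟪(u : E), T u⟫_ℂ + k * ⟪(u : E), (u : E)⟫_ℂ).re := fun u => by
    rw [Complex.add_re, re_mul_inner_self]
    have := hC u
    simp only [k]
    linarith
  -- The type synonym avoids a clash with the norm that `T.domain` inherits from `E`.
  let core : InnerProductSpace.Core ℂ (FormDomain T) :=
    { inner := fun u v => ⟪((show T.domain from u) : E), T v⟫_ℂ +
        k * ⟪((show T.domain from u) : E), ((show T.domain from v) : E)⟫_ℂ
      conj_inner_symm := fun u v => by
        have h := hT u v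
        simp [h]
      re_inner_nonneg := fun u => (sq_nonneg _).trans (hk u)
      add_left := fun u v w => by
        change ⟪((show T.domain from u) : E) + ((show T.domain from v) : E), _⟫_ℂ +
          k * ⟪((show T.domain from u) : E) + ((show T.domain from v) : E), _⟫_ℂ = _
        simp only [inner_add_left]
        ring
      smul_left := fun u v c => by
        change ⟪c • ((show T.domain from u) : E), _⟫_ℂ +
          k * ⟪c • ((show T.domain from u) : E), _⟫_ℂ = _
        simp only [inner_smul_left]
        ring
      definite := fun u hu => by
        have h := hk u
        rw [show ⟪((show T.domain from u) : E), T u⟫_ℂ + _ = 0 from hu] at h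
        have h0 : ‖((show T.domain from u) : E)‖ = 0 :=
          pow_eq_zero_iff two_ne_zero |>.1 (le_antisymm h (sq_nonneg _))
        exact Subtype.ext (norm_eq_zero.1 h0) }
  let _ : NormedAddCommGroup (FormDomain T) := core.toNormedAddCommGroup
  let _ : InnerProductSpace ℂ (FormDomain T) := InnerProductSpace.ofCore core.toCore
  let e : (ofOperator T).domain ≃ₗ[ℂ] FormDomain T := LinearEquiv.refl ℂ T.domain
  have he : ∀ u v : T.domain, ⟪e u, e v⟫_ℂ = ⟪(u : E), T v⟫_ℂ + k * ⟪(u : E), (v : E)⟫_ℂ :=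
    fun u v => rfl
  refine exists_isClosureOf_of_inner (ofOperator T) e k he (fun u => ?_)
    (fun u => T u + (k : ℂ) • (u : E)) fun u v => ?_
  · refine le_of_sq_le_sq ((hk u).trans_eq ?_) (norm_nonneg _)
    exact (norm_sq_eq_re_inner (𝕜 := ℂ) (e u)).symm
  · refine (he u v).trans ?_
    rw [inner_add_left, inner_smul_left, Complex.conj_ofReal]
    exact congrArg (· + _) (hT u v)

theorem closure_isClosureOf {t : SesqForm E} (h : ∃ c : SesqForm E, c.IsClosureOf t) :
    t.closure.IsClosureOf t := by
  rw [closure, dif_pos h]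
  exact h.choose_spec

/-! ### Convergence with respect to the form -/

theorem quad_neg (t : SesqForm E) (v : t.domain) : t.quad (-v) = t.quad v := by
  simp [quad]

theorem quad_add_add_quad_sub (t : SesqForm E) (v w : t.domain) :
    t.quad (v + w) + t.quad (v - w) = 2 * (t.quad v + t.quad w) := by
  simp only [quad, map_add, map_sub, LinearMap.add_apply, LinearMap.sub_apply, Complex.add_re,
    Complex.sub_re]
  ring

theorem IsHermitian.quad_sub {t : SesqForm E} (ht : t.IsHermitian) (v w : t.domain) :
    t.quad (v - w) = t.quad v - 2 * (t.form v w).re + t.quad w := by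
  have h : (t.form w v).re = (t.form v w).re := by rw [ht w v, Complex.conj_re]
  simp only [quad, map_sub, LinearMap.sub_apply, Complex.sub_re, h]
  ring

theorem Extends.form_eq_inner {c : SesqForm E} {T : E →ₗ.[ℂ] E} (h : c.Extends (ofOperator T))
    {v w : c.domain} (hv : (v : E) ∈ T.domain) (hw : (w : E) ∈ T.domain) :
    c.form v w = ⟪(v : E), T ⟨w, hw⟩⟫_ℂ := by
  obtain ⟨_, h⟩ := h
  exact h ⟨v, hv⟩ ⟨w, hw⟩

/-- Let `s n → u` with respect to the form. If `a n → u` in `E` and the form does not increase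
from `s n` to `a n`, then `a n → u` with respect to the form. -/
theorem IsClosureOf.tendsto_quad_sub {c : SesqForm E} {T : E →ₗ.[ℂ] E}
    (hc : c.IsClosureOf (ofOperator T)) {u : c.domain} {s a : ℕ → c.domain}
    (hsT : ∀ n, (s n : E) ∈ T.domain) (haT : ∀ n, (a n : E) ∈ T.domain)
    (hs : Tendsto (fun n => (s n : E)) atTop (𝓝 u))
    (hsq : Tendsto (fun n => c.quad (s n - u)) atTop (𝓝 0))
    (ha : Tendsto (fun n => (a n : E)) atTop (𝓝 u)) (hle : ∀ n, c.quad (a n) ≤ c.quad (s n)) :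
    Tendsto (fun n => c.quad (a n - u)) atTop (𝓝 0) := by
  obtain ⟨C, hC⟩ := hc.isLowerSemibounded
  let q : c.domain → ℝ := fun w => c.quad w - C * ‖(w : E)‖ ^ 2
  have hq0 : ∀ w, 0 ≤ q w := fun w => sub_nonneg.2 (hC w)
  have hqsymm : ∀ v w, q (v - w) = q (w - v) := fun v w => by
    simp only [q]
    rw [← neg_sub w v, quad_neg, NegMemClass.coe_neg, norm_neg]
  -- Parallelogram law for `q`, with the nonnegative term `q (v - x - (x - w))` dropped.
  have hqtri : ∀ v x w, q (v - w) ≤ 2 * q (v - x) + 2 * q (x - w) := fun v x w => by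
    have h1 := c.quad_add_add_quad_sub (v - x) (x - w)
    have h2 := parallelogram_law_with_norm ℂ ((v - x : c.domain) : E) ((x - w : c.domain) : E)
    have h3 := hq0 (v - x - (x - w))
    have h4 : ((v - x : c.domain) : E) + ((x - w : c.domain) : E) = ((v - w : c.domain) : E) := by
      push_cast
      abel
    rw [sub_add_sub_cancel] at h1
    rw [h4] at h2
    simp only [q] at h3 ⊢
    rw [AddSubgroupClass.coe_sub (v - x)] at h3
    linear_combination h3 + h1 - C * h2
  have hnu : ∀ {r : ℕ → c.domain}, Tendsto (fun n => (r n : E)) atTop (𝓝 u) → ∀ w : c.domain,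
      Tendsto (fun n => ‖((r n - w : c.domain) : E)‖ ^ 2) atTop
        (𝓝 (‖((u - w : c.domain) : E)‖ ^ 2)) := fun h w => by
    simpa using ((h.sub_const (w : E)).norm).pow 2
  have hnu0 : ∀ {r : ℕ → c.domain}, Tendsto (fun n => (r n : E)) atTop (𝓝 u) →
      Tendsto (fun n => C * ‖((r n - u : c.domain) : E)‖ ^ 2) atTop (𝓝 0) := fun h => by
    simpa using (hnu h u).const_mul C
  have hqs : Tendsto (fun n => q (s n - u)) atTop (𝓝 0) := by
    simpa [q] using hsq.sub (hnu0 hs)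
  -- What remains of `q (a n - s m) - q (s n - s m)` once `quad (a n) ≤ quad (s n)` is used. For
  -- fixed `m` it vanishes as `n → ∞`, since `s n` and `a n` have the same limit in `E`.
  let d : ℕ → ℕ → ℝ := fun m n => 2 * (⟪(s n : E) - a n, T ⟨s m, hsT m⟩⟫_ℂ).re +
    C * (‖((s n - s m : c.domain) : E)‖ ^ 2 - ‖((a n - s m : c.domain) : E)‖ ^ 2)
  have hd : ∀ m, Tendsto (d m) atTop (𝓝 0) := fun m => by
    have h1 : Tendsto (fun n => (⟪(s n : E) - a n, T ⟨s m, hsT m⟩⟫_ℂ).re) atTop (𝓝 0) := by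
      have h : Tendsto (fun n => ⟪(s n : E) - a n, T ⟨s m, hsT m⟩⟫_ℂ) atTop (𝓝 0) := by
        rw [← inner_zero_left (𝕜 := ℂ) (T ⟨s m, hsT m⟩), ← sub_self (u : E)]
        exact (hs.sub ha).inner tendsto_const_nhds
      simpa [Function.comp_def] using (Complex.continuous_re.tendsto _).comp h
    simpa [d] using (h1.const_mul 2).add (((hnu hs (s m)).sub (hnu ha (s m))).const_mul C)
  have hqd : ∀ m n, q (a n - s m) ≤ q (s n - s m) + d m n := fun m n => by
    have h1 := hc.isHermitian.quad_sub (a n) (s m)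
    have h2 := hc.isHermitian.quad_sub (s n) (s m)
    rw [hc.extends_form.form_eq_inner (haT n) (hsT m)] at h1
    rw [hc.extends_form.form_eq_inner (hsT n) (hsT m)] at h2
    have h3 := hle n
    simp only [q, d, inner_sub_left, Complex.sub_re]
    linarith
  have hqa : Tendsto (fun n => q (a n - u)) atTop (𝓝 0) := by
    rw [Metric.tendsto_atTop']
    intro ε hε
    -- Two uses of `hqtri` give `q (a n - u) ≤ 4 q (s n - u) + 6 q (s m - u) + 2 d m n`, and 4 + 6 +
    -- 2 = 12. The index `m` is fixed before `n` grows.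
    have hε' : 0 < ε / 12 := by positivity
    obtain ⟨m, hm⟩ := (hqs.eventually_lt_const hε').exists
    obtain ⟨N, hN⟩ := eventually_atTop.1
      ((hqs.eventually_lt_const hε').and ((hd m).eventually_lt_const hε'))
    refine ⟨N, fun n hn => ?_⟩
    obtain ⟨h1, h2⟩ := hN n hn.le
    rw [Real.dist_eq, sub_zero, abs_of_nonneg (hq0 _)]
    have h3 := hqtri (a n) (s m) u
    have h4 := hqd m n
    have h5 := hqtri (s n) u (s m)
    rw [hqsymm u] at h5
    linarith
  simpa [q] using hqa.add (hnu0 ha)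

/-- The closure of the form of a densely defined, symmetric, lower semi-bounded operator is the
form of its Friedrichs extension. -/
theorem closure_isFormOf_friedrichsExtension {T : E →ₗ.[ℂ] E} (hT : Dense (T.domain : Set E))
    (hc : (ofOperator T).closure.IsClosureOf (ofOperator T)) :
    (ofOperator T).closure.IsFormOf (friedrichsExtension T) where
  dense := by
    obtain ⟨h, _⟩ := hc.extends_form
    exact hT.mono h
  isHermitian := hc.isHermitian
  isLowerSemibounded := hc.isLowerSemibounded
  isClosed := hc.isClosed
  operator_eq := rfl

theorem tendsto_formNorm_zero {t : SesqForm E} {s : ℕ → t.domain} {u : t.domain}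
    (hs : Tendsto (fun n => (s n : E)) atTop (𝓝 u))
    (hq : Tendsto (fun n => t.quad (s n - u)) atTop (𝓝 0)) (β : ℝ) :
    Tendsto (fun n => t.formNorm β (s n - u)) atTop (𝓝 0) := by
  have h : Tendsto (fun n => ‖((s n - u : t.domain) : E)‖ ^ 2) atTop (𝓝 0) := by
    simpa using ((hs.sub_const (u : E)).norm).pow 2
  have h' := (Real.continuous_sqrt.tendsto _).comp (hq.add (h.const_mul (β - t.lowerBound)))
  simpa [formNorm, Function.comp_def] using h'

end SesqForm

/-! ### Absolute values and finitely supported functions in `ℓ²(X, μ)` -/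

namespace WeightedGraph

variable {X : Type*} {G : WeightedGraph X}

theorem L2.norm_apply_sq (u : G.L2) (x : X) : ‖u x‖ ^ 2 = G.μ x * ‖u.fn x‖ ^ 2 :=
  norm_lift_sq u.fn x

theorem L2.summable_norm_sq (u : G.L2) : Summable fun x => G.μ x * ‖u.fn x‖ ^ 2 :=
  (memℓp_lift_iff u.fn).1 (lp.memℓp u)

theorem L2.norm_le_of_forall_norm_fn_le {u v : G.L2} (h : ∀ x, ‖u.fn x‖ ≤ ‖v.fn x‖) :
    ‖u‖ ≤ ‖v‖ := by
  refine lp.norm_mono two_ne_zero fun x => ?_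
  refine le_of_sq_le_sq ?_ (norm_nonneg _)
  rw [norm_apply_sq, norm_apply_sq]
  have := G.μ_pos x
  gcongr
  exact h x

/-- The pointwise absolute value in `ℓ²(X, μ)`. -/
def L2.abs (u : G.L2) : G.L2 :=
  ⟨G.lift fun x => (‖u.fn x‖ : ℂ), (memℓp_lift_iff _).2 (by simpa using u.summable_norm_sq)⟩

@[simp]
theorem L2.fn_abs (u : G.L2) (x : X) : u.abs.fn x = (‖u.fn x‖ : ℂ) := rfl

theorem L2.abs_mem_Cc {u : G.L2} (hu : u ∈ G.Cc) : u.abs ∈ G.Cc := by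
  refine Set.Finite.subset hu fun x hx => ?_
  simpa using hx

theorem L2.norm_abs_sub_le {u v : G.L2} (hv : ∀ x, 0 ≤ v.fn x) : ‖u.abs - v‖ ≤ ‖u - v‖ := by
  refine norm_le_of_forall_norm_fn_le fun x => ?_
  change ‖(‖u.fn x‖ : ℂ) - v.fn x‖ ≤ ‖u.fn x - v.fn x‖
  have h : v.fn x = (‖v.fn x‖ : ℂ) := Complex.eq_coe_norm_of_nonneg (hv x)
  calc ‖(‖u.fn x‖ : ℂ) - v.fn x‖ = |‖u.fn x‖ - ‖v.fn x‖| := by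
        conv_lhs => rw [h]
        rw [← Complex.ofReal_sub, Complex.norm_real, Real.norm_eq_abs]
    _ ≤ ‖u.fn x - v.fn x‖ := abs_norm_sub_norm_le _ _

theorem dense_Cc : Dense (G.Cc : Set G.L2) := by
  classical
  intro u
  refine mem_closure_of_tendsto (lp.hasSum_single (by simp) u) (Eventually.of_forall fun s => ?_)
  refine Submodule.sum_mem _ fun x _ => ?_
  refine (Set.finite_singleton x).subset fun y hy => ?_
  by_contra hne
  exact hy (lp.single_apply_ne 2 x (u x) hne)

/-! ### The Schrödinger form on finitely supported functions -/

/-- Separates a real diagonal part, holding the full vertex degree and the potential, from the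
off-diagonal part with coefficients `-b x y`. Symmetry and the comparison with absolute values can
then be read off from finite sums. -/
theorem inner_schrodinger (hG : G.FinitenessCondition) (V : X → ℝ)
    (u v : (G.schrodinger hG V).domain) (S : Finset X) (hu : Function.support (L2.fn u.1) ⊆ S)
    (hv : Function.support (L2.fn v.1) ⊆ S) :
    ⟪(u : G.L2), G.schrodinger hG V v⟫_ℂ =
      ∑ x ∈ S, (((∑' y, G.b x y) + G.μ x * V x : ℝ) : ℂ) *
          (starRingEnd ℂ (L2.fn u.1 x) * L2.fn v.1 x) -
        ∑ x ∈ S, ∑ y ∈ S, (G.b x y : ℂ) * (starRingEnd ℂ (L2.fn u.1 x) * L2.fn v.1 y) := by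
  have hv' : ∀ x, G.formalSchrodinger V (L2.fn v.1) x =
      (1 / (G.μ x : ℂ) * (∑' y, (G.b x y : ℂ)) + (V x : ℂ)) * L2.fn v.1 x
        - ∑ y ∈ S, L2.fn v.1 y * ((G.b y x / G.μ x : ℝ) : ℂ) := fun x => by
    have hfin : (Function.support (L2.fn v.1)).Finite := v.2
    rw [formalSchrodinger_eq V hfin]
    congr 1
    refine Finset.sum_subset (hfin.toFinset_subset.2 hv) fun y _ hy => ?_
    have : L2.fn v.1 y = 0 := by simpa using hy
    simp [this]
  rw [inner_eq, tsum_eq_sum (s := S), ← Finset.sum_sub_distrib]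
  · refine Finset.sum_congr rfl fun x _ => ?_
    change (G.μ x : ℂ) * (_ * G.formalSchrodinger V (L2.fn v.1) x) = _
    have hμ : (G.μ x : ℂ) ≠ 0 := by exact_mod_cast (G.μ_pos x).ne'
    have h : ∑ y ∈ S, L2.fn v.1 y * ((G.b y x / G.μ x : ℝ) : ℂ) =
        (∑ y ∈ S, (G.b x y : ℂ) * L2.fn v.1 y) / G.μ x := by
      rw [Finset.sum_div]
      refine Finset.sum_congr rfl fun y _ => ?_
      rw [G.b_symm y x]
      push_cast
      ring
    have h' : ∑ y ∈ S, (G.b x y : ℂ) * (starRingEnd ℂ (L2.fn u.1 x) * L2.fn v.1 y) =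
        starRingEnd ℂ (L2.fn u.1 x) * ∑ y ∈ S, (G.b x y : ℂ) * L2.fn v.1 y := by
      rw [Finset.mul_sum]
      exact Finset.sum_congr rfl fun y _ => by ring
    rw [hv', h, h']
    push_cast
    field_simp
  · intro x hx
    have : L2.fn u.1 x = 0 := by
      by_contra h
      exact hx (hu h)
    simp [this]

theorem exists_support_subset (u v : G.Cc) :
    ∃ S : Finset X, Function.support (L2.fn u.1) ⊆ S ∧ Function.support (L2.fn v.1) ⊆ S := by
  have h : (Function.support (L2.fn u.1) ∪ Function.support (L2.fn v.1)).Finite := u.2.union v.2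
  refine ⟨h.toFinset, ?_, ?_⟩ <;> simp

theorem schrodinger_symmetric (hG : G.FinitenessCondition) (V : X → ℝ)
    (u v : (G.schrodinger hG V).domain) :
    ⟪(u : G.L2), G.schrodinger hG V v⟫_ℂ = ⟪G.schrodinger hG V u, (v : G.L2)⟫_ℂ := by
  obtain ⟨S, hu, hv⟩ := exists_support_subset u v
  rw [← inner_conj_symm (G.schrodinger hG V u), inner_schrodinger hG V u v S hu hv,
    inner_schrodinger hG V v u S hv hu]
  simp only [map_sub, map_sum, map_mul, Complex.conj_ofReal, Complex.conj_conj]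
  rw [Finset.sum_comm (s := S) (t := S)]
  congr 1
  · exact Finset.sum_congr rfl fun x _ => by ring
  · refine Finset.sum_congr rfl fun x _ => Finset.sum_congr rfl fun y _ => ?_
    rw [G.b_symm y x]
    ring

/-- Passing to the absolute value does not increase the form of the Schrödinger operator. -/
theorem re_inner_schrodinger_abs_le (hG : G.FinitenessCondition) (V : X → ℝ)
    (u : (G.schrodinger hG V).domain) :
    (⟪u.1.abs, G.schrodinger hG V ⟨u.1.abs, L2.abs_mem_Cc u.2⟩⟫_ℂ).re ≤
      (⟪(u : G.L2), G.schrodinger hG V u⟫_ℂ).re := by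
  obtain ⟨S, hu, hau⟩ := exists_support_subset u ⟨u.1.abs, L2.abs_mem_Cc u.2⟩
  rw [inner_schrodinger hG V u u S hu hu,
    inner_schrodinger hG V ⟨u.1.abs, L2.abs_mem_Cc u.2⟩ ⟨u.1.abs, L2.abs_mem_Cc u.2⟩ S hau hau]
  simp only [Complex.sub_re, Complex.re_sum, Complex.re_ofReal_mul, L2.fn_abs]
  -- The diagonal part depends only on `|u x|`, whatever the sign of `V`. The subtracted part can
  -- only grow, as `Re (conj (u x) * u y) ≤ |u x| |u y|` and `b ≥ 0`.
  refine sub_le_sub (Finset.sum_le_sum fun x _ => le_of_eq ?_)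
    (Finset.sum_le_sum fun x _ => Finset.sum_le_sum fun y _ =>
      mul_le_mul_of_nonneg_left ?_ (G.b_nonneg x y))
  · rw [Complex.conj_mul', Complex.conj_mul']
    simp
  · refine (Complex.re_le_norm _).trans_eq ?_
    rw [Complex.conj_ofReal, ← Complex.ofReal_mul, Complex.ofReal_re]
    simp

end WeightedGraph

end

/-! ### The positive form core -/

theorem proposition3 {X : Type*} [Countable X] [Nonempty X] (G : WeightedGraph X)
    (hG : G.FinitenessCondition) (V₁ : X → ℝ)
    (hV₁ : ∃ C : ℝ, ∀ u : (G.schrodinger hG V₁).domain,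
      C * ‖(u : G.L2)‖ ^ 2 ≤ (inner ℂ (u : G.L2) (G.schrodinger hG V₁ u)).re) :
    WeightedGraph.HasPositiveFormCore (friedrichsExtension (G.schrodinger hG V₁)) := by
  obtain ⟨C, hC⟩ := hV₁
  have hc := SesqForm.closure_isClosureOf
    (SesqForm.exists_isClosureOf_ofOperator _ (WeightedGraph.schrodinger_symmetric hG V₁) hC)
  refine ⟨_, SesqForm.closure_isFormOf_friedrichsExtension WeightedGraph.dense_Cc hc,
    fun u hu => ?_⟩
  obtain ⟨s, hsT, hs, hsq⟩ := hc.core u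
  obtain ⟨hle, -⟩ := id hc.extends_form
  have haT : ∀ n, (s n).1.abs ∈ G.Cc := fun n => WeightedGraph.L2.abs_mem_Cc (hsT n)
  have ha : Tendsto (fun n => (s n).1.abs) atTop (𝓝 u.1) := by
    rw [tendsto_iff_norm_sub_tendsto_zero] at hs ⊢
    exact squeeze_zero (fun _ => norm_nonneg _) (fun n => WeightedGraph.L2.norm_abs_sub_le hu) hs
  let a : ℕ → (SesqForm.ofOperator (G.schrodinger hG V₁)).closure.domain :=
    fun n => ⟨(s n).1.abs, hle (haT n)⟩
  have haq := hc.tendsto_quad_sub (a := a) hsT haT hs hsq ha fun n => by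
    rw [SesqForm.quad, SesqForm.quad,
      hc.extends_form.form_eq_inner (v := a n) (w := a n) (haT n) (haT n),
      hc.extends_form.form_eq_inner (hsT n) (hsT n)]
    exact WeightedGraph.re_inner_schrodinger_abs_le hG V₁ ⟨(s n).1, hsT n⟩
  refine ⟨a, fun n => ⟨haT n, fun x => ?_⟩, fun β _ => SesqForm.tendsto_formNorm_zero ha haq β⟩
  change (0 : ℂ) ≤ (‖(s n).1.fn x‖ : ℂ)
  exact_mod_cast norm_nonneg _
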